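/- A \emph{body-bar multigraph} $G$ in the plane consists of finite sets $V_n$ (non-trivial bodies), $V_m$ (point-like bodies), $J$ (surface joints, each carried by one body in $V_n$) and $E$ (edges, or bars). The \emph{sites} are the elements of $V_m$ and of $J$; every edge joins two sites, and is thereby incident to the two bodies to which these sites belong (a site in $V_m$ belongs to itself). Parallel edges and loops are allowed. Assume \emph{generic incidence}: at most two edges are incident to any one surface joint, and no two distinct edges join the same pair of sites if at least one of these sites is a surface joint (there is no such restriction for edges between two point-like bodies). A \emph{realization} assigns to every site $i$ a position $x_i\in\mathbb R^2$; it is \emph{generic} if all coordinates of all sites are algebraically independent over $\mathbb Q$. Its \emph{rigidity matrix} has three columns for each $a\in V_n$ (the velocity $v_a\in\mathbb R^2$ and the angular velocity $\omega_a\in\mathbb R$), two columns for each $a\in V_m$ (the velocity $v_a$, with $\omega_a=0$), and one row for each edge: an edge joining site $i$ of $a$ to site $j$ of $b$ gives the row of the linear form $$(x_i-x_j)\cdot(v_a-v_b)+(x_j\wedge x_i)(\omega_a-\omega_b),\qquad x\wedge y=x_1y_2-x_2y_1 .$$ The edges of $G$ are \emph{independent in two dimensions} if the rows of the rigidity matrix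 are linearly independent at every generic realization. For a multigraph $H$ on the node set $V_n\cup V_m$, let $B(H)$ be the bipartite graph with parts $V1$, the set of edges of $H$, and $V2$, consisting of 3 copies of each element of $V_n$ and 2 copies of each element of $V_m$, in which an edge of $H$ is adjacent to all copies of the nodes to which it is incident. For an edge $ab$ of $G$, let $G_{ab}$ be the multigraph on $V_n\cup V_m$ obtained from $G$ by replacing $ab$ by four parallel edges. \textbf{Theorem.} The following are equivalent: (A) the edges of $G$ are independent in two dimensions; (A$'$) the rows of the rigidity matrix of $G$ are linearly independent at some generic realization; (B) for every edge $ab$ of $G$, the multigraph $G_{ab}$ has no subgraph with $b'>3n'+2m'$, where $b'$, $n'$, $m'$ are the numbers of its edges, of its nodes in $V_n$ and of its nodes in $V_m$; (C) for every edge $ab$ of $G$, the bipartite graph $B(G_{ab})$ has no subset of $V1$ that is adjacent only to a smaller subset of $V2$; (D) for every edge $ab$ of $G$, $B(G_{ab})$ has a complete matching from $V1$ to $V2$, i.e. a matching covering every node of $V1$. -/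

import Mathlib

/-- A mixed multigraph: nodes are the non-trivial bodies `Vn` and the point-like bodies `Vm`,
edges are the elements of `E`. Parallel edges and loops are allowed. -/
structure MixedMultigraph (Vn Vm E : Type*) where
  /-- the unordered pair of nodes to which an edge is incident -/
  ends : E → Sym2 (Vn ⊕ Vm)

namespace MixedMultigraph

variable {Vn Vm E : Type*}

/-- The multigraph obtained by quadrupling the edge `e`: three further edges parallel to `e`
are added. -/
def quadruple (G : MixedMultigraph Vn Vm E) (e : E) : MixedMultigraph Vn Vm (E ⊕ Fin 3) where
  ends := Sum.elim G.ends (fun _ => G.ends e)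

/-- A subgraph: a set of bodies, a set of points, and a set of edges both of whose ends lie in the
chosen set of nodes. -/
structure Sub (G : MixedMultigraph Vn Vm E) where
  bodies : Finset Vn
  points : Finset Vm
  edges : Finset E
  ends_mem : ∀ e ∈ edges, ∀ v ∈ G.ends e, Sum.elim (· ∈ bodies) (· ∈ points) v

/-- Three copies of every non-trivial body and two copies of every point-like body. -/
abbrev Copies (Vn Vm : Type*) : Type _ := (Vn × Fin 3) ⊕ (Vm × Fin 2)

/-- The node of which an element of `Copies` is a copy. -/
def nodeOfCopy : Copies Vn Vm → Vn ⊕ Vm :=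
  Sum.map Prod.fst Prod.fst

/-- The bipartite graph `B(G)`, with `V1 = E` (left summand) and `V2 = Copies Vn Vm` (right
summand): an edge of `G` is adjacent to all copies of the nodes to which it is incident. -/
def bipartite (G : MixedMultigraph Vn Vm E) : SimpleGraph (E ⊕ Copies Vn Vm) where
  Adj
    | Sum.inl e, Sum.inr c => nodeOfCopy c ∈ G.ends e
    | Sum.inr c, Sum.inl e => nodeOfCopy c ∈ G.ends e
    | _, _ => False
  symm := ⟨by rintro (e | c) (e' | c') h <;> exact h⟩
  loopless := ⟨by rintro (e | c) h <;> exact h⟩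

/-- Some set of `V1` nodes of `B(G)` is adjacent only to a smaller set of `V2` nodes. -/
def HasDeficientSet (G : MixedMultigraph Vn Vm E) : Prop :=
  ∃ (S : Finset E) (T : Finset (Copies Vn Vm)),
    (∀ e ∈ S, ∀ c, G.bipartite.Adj (Sum.inl e) (Sum.inr c) → c ∈ T) ∧ T.card < S.card

/-- `B(G)` has a complete matching from `V1` to `V2`, i.e. a matching covering every node of
`V1`. -/
def HasCompleteMatching (G : MixedMultigraph Vn Vm E) : Prop :=
  ∃ M : G.bipartite.Subgraph, M.IsMatching ∧ ∀ e : E, Sum.inl e ∈ M.verts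

end MixedMultigraph

/-- A planar body-bar structure: `Vn` are the non-trivial bodies, `Vm` the point-like bodies,
`J` the joints on the surfaces of the non-trivial bodies, `E` the (external) bars. The sites are the
point-like bodies and the surface joints; each bar joins two sites. -/
structure BodyBarGraph (Vn Vm J E : Type*) where
  /-- the body that carries a joint -/
  body : J → Vn
  /-- first end of a bar -/
  fst : E → Vm ⊕ J
  /-- second end of a bar -/
  snd : E → Vm ⊕ J

namespace BodyBarGraph

variable {Vn Vm J E : Type*}

/-- The (trivial or non-trivial) body to which a site belongs. -/
def node (G : BodyBarGraph Vn Vm J E) : Vm ⊕ J → Vn ⊕ Vm :=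
  Sum.elim Sum.inr (fun j => Sum.inl (G.body j))

/-- The unordered pair of sites joined by a bar. -/
def sites (G : BodyBarGraph Vn Vm J E) (e : E) : Sym2 (Vm ⊕ J) := s(G.fst e, G.snd e)

/-- The underlying multigraph on bodies. -/
def toMultigraph (G : BodyBarGraph Vn Vm J E) : MixedMultigraph Vn Vm E where
  ends e := (G.sites e).map G.node

/-- Generic incidence: at most two bars are incident to a joint of a non-trivial body, and no two
different bars have the same two end sites when at least one of these is a joint of a non-trivial
body (so bars incident to the same body are not forced to lie on the same line). -/
structure GenericIncidence (G : BodyBarGraph Vn Vm J E) : Prop where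
  encard_le_two : ∀ j : J, {e : E | Sum.inr j ∈ G.sites e}.encard ≤ 2
  eq_of_sites_eq : ∀ (e f : E) (j : J), Sum.inr j ∈ G.sites e → G.sites e = G.sites f → e = f

/-- The line-bound vector `(x - y, y ∧ x)` of a bar from `x` to `y`. -/
def lineBound (x y : Fin 2 → ℝ) : Fin 3 → ℝ :=
  ![x 0 - y 0, x 1 - y 1, y 0 * x 1 - y 1 * x 0]

open Classical in
/-- `1` at the first end of `e`, `-1` at the second end, and `0` at the other nodes; `0` everywhere
if both ends of `e` lie on the same body. -/
noncomputable def incidence (G : BodyBarGraph Vn Vm J E) (e : E) (v : Vn ⊕ Vm) : ℝ :=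
  (if G.node (G.fst e) = v then 1 else 0) - (if G.node (G.snd e) = v then 1 else 0)

/-- The rigidity matrix at the realization `p`. There is one row for each bar. Each non-trivial
body `a` has three columns, for the two components of the velocity `v_a` and for the angular
velocity `ω_a` (reference point at the origin); each point-like body has two columns, for its
velocity. The row of a bar from site `i` on `a` to site `j` on `b` expresses the equation
`(x_i - x_j) · (v_a - v_b) + (x_j ∧ x_i) (ω_a - ω_b) = 0`, with `ω = 0` for point-like bodies. -/
noncomputable def rigidityMatrix (G : BodyBarGraph Vn Vm J E) (p : Vm ⊕ J → Fin 2 → ℝ) :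
    Matrix E ((Vn × Fin 3) ⊕ (Vm × Fin 2)) ℝ :=
  Matrix.of fun e c =>
    match c with
    | Sum.inl (a, k) => G.incidence e (Sum.inl a) * lineBound (p (G.fst e)) (p (G.snd e)) k
    | Sum.inr (v, k) =>
        G.incidence e (Sum.inr v) * lineBound (p (G.fst e)) (p (G.snd e)) k.castSucc

/-- The bars are independent at the realization `p`: the rows of the rigidity matrix are linearly
independent. -/
def IndependentAt (G : BodyBarGraph Vn Vm J E) (p : Vm ⊕ J → Fin 2 → ℝ) : Prop :=
  LinearIndependent ℝ (G.rigidityMatrix p).row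

/-- A realization is generic if the coordinates of all sites are algebraically independent over
the rationals. -/
def IsGeneric (p : Vm ⊕ J → Fin 2 → ℝ) : Prop :=
  AlgebraicIndependent ℚ (fun s : (Vm ⊕ J) × Fin 2 => p s.1 s.2)

/-- The edges are independent in two dimensions: they are independent at every generic
realization. -/
def IndependentIn2D (G : BodyBarGraph Vn Vm J E) : Prop :=
  ∀ p : Vm ⊕ J → Fin 2 → ℝ, IsGeneric p → G.IndependentAt p

end BodyBarGraph

/-! Conditions (B), (C), (D) are linked by Hall's theorem, the neighbours of a set of edges being
all copies of the incident nodes. Quadrupling an edge adds 3 to the count, so (B) amounts to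
`IsSparse`: any `k ≥ 1` edges with ends among `n'` bodies and `m'` points satisfy `k + 3 ≤ 3n' +
2m'`.

Independence at a generic realization forces this count: the rows of the chosen edges map the
velocities of the chosen nodes onto all loads, and the kernel contains the three-dimensional space
of rigid motions (`IndependentAt.card_add_three_le`).

Conversely, by `IndependentAt.of_generic` it suffices to find one independent realization. Each
non-trivial body is replaced by a bar-joint frame: a base bar, and two bars from every joint to its
ends. Generic incidence makes the resulting graph (2,3)-sparse (`IsSparse.frame_sparse`), Laman's
theorem places it independently (`exists_placement_of_sparse`), and the unloaded frames move as
rigid bodies, so independence passes to the body-bar structure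
(`independentAt_of_frame_independent`).

Laman's theorem is proved through directions: Rado's theorem gives independent edge directions for a
(2,2)-sparse graph, and doubling an edge of a (2,3)-sparse graph keeps it (2,2)-sparse. This allows
a placement with prescribed generic edge directions in which no edge collapses. -/

namespace MixedMultigraph

/-! ### Deficient sets, subgraph counts and Hall's theorem -/

variable {Vn Vm E : Type*}

theorem bipartite_adj_iff (G : MixedMultigraph Vn Vm E) (e : E) (c : Copies Vn Vm) :
    G.bipartite.Adj (Sum.inl e) (Sum.inr c) ↔ nodeOfCopy c ∈ G.ends e := Iff.rfl

theorem hasDeficientSet_iff_exists_sub [Finite Vn] [Finite Vm]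
    (G : MixedMultigraph Vn Vm E) :
    G.HasDeficientSet ↔ ∃ H : G.Sub, H.edges.card > 3 * H.bodies.card + 2 * H.points.card := by
  classical
  cases nonempty_fintype Vn
  cases nonempty_fintype Vm
  constructor
  · rintro ⟨S, T, hST, hcard⟩
    refine ⟨⟨{a | ∃ e ∈ S, Sum.inl a ∈ G.ends e}, {v | ∃ e ∈ S, Sum.inr v ∈ G.ends e}, S, ?_⟩, ?_⟩
    · rintro e he (a | v) hv
      · simpa using ⟨e, he, hv⟩
      · simpa using ⟨e, he, hv⟩
    · refine lt_of_le_of_lt ?_ hcard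
      set A : Finset Vn := {a | ∃ e ∈ S, Sum.inl a ∈ G.ends e} with hA
      set P : Finset Vm := {v | ∃ e ∈ S, Sum.inr v ∈ G.ends e} with hP
      -- Adjacency is to all copies of a node at once, so `T` contains the full `3|A| + 2|P|`
      -- copies.
      have hsub : (A ×ˢ (Finset.univ : Finset (Fin 3))).disjSum
          (P ×ˢ (Finset.univ : Finset (Fin 2))) ⊆ T := by
        rintro (⟨a, k⟩ | ⟨v, k⟩) hc
        · obtain ⟨e, he, h⟩ : ∃ e ∈ S, Sum.inl a ∈ G.ends e := by simpa [hA] using hc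
          exact hST e he _ ((G.bipartite_adj_iff e _).2 h)
        · obtain ⟨e, he, h⟩ : ∃ e ∈ S, Sum.inr v ∈ G.ends e := by simpa [hP] using hc
          exact hST e he _ ((G.bipartite_adj_iff e _).2 h)
      have := Finset.card_le_card hsub
      simp only [Finset.card_disjSum, Finset.card_product, Finset.card_univ,
        Fintype.card_fin] at this
      linarith
  · rintro ⟨H, hH⟩
    refine ⟨H.edges, (H.bodies ×ˢ (Finset.univ : Finset (Fin 3))).disjSum
          (H.points ×ˢ (Finset.univ : Finset (Fin 2))), ?_, ?_⟩
    · rintro e he (⟨a, k⟩ | ⟨v, k⟩) h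
      · simpa [nodeOfCopy] using H.ends_mem e he _ h
      · simpa [nodeOfCopy] using H.ends_mem e he _ h
    · simp only [Finset.card_disjSum, Finset.card_product, Finset.card_univ,
        Fintype.card_fin]
      linarith

theorem exists_injective_iff_hasCompleteMatching (G : MixedMultigraph Vn Vm E) :
    (∃ f : E → Copies Vn Vm, Function.Injective f ∧ ∀ e, nodeOfCopy (f e) ∈ G.ends e) ↔
      G.HasCompleteMatching := by
  constructor
  · rintro ⟨f, hf, hadj⟩
    refine ⟨⟨Set.range Sum.inl ∪ Set.range (Sum.inr ∘ f),
      fun x y => ∃ e, (x = Sum.inl e ∧ y = Sum.inr (f e)) ∨ (y = Sum.inl e ∧ x = Sum.inr (f e)),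
      ?_, ?_, ?_⟩, ?_, ?_⟩
    · rintro x y ⟨e, ⟨rfl, rfl⟩ | ⟨rfl, rfl⟩⟩ <;> exact hadj e
    · rintro x y ⟨e, ⟨rfl, rfl⟩ | ⟨rfl, rfl⟩⟩ <;> simp
    · exact ⟨fun x y ⟨e, h⟩ => ⟨e, h.symm⟩⟩
    · rintro v (⟨e, rfl⟩ | ⟨e, rfl⟩)
      · refine ⟨Sum.inr (f e), ⟨e, Or.inl ⟨rfl, rfl⟩⟩, ?_⟩
        rintro y ⟨e', ⟨h, rfl⟩ | ⟨rfl, h⟩⟩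
        · cases h; rfl
        · cases h
      · refine ⟨Sum.inl e, ⟨e, Or.inr ⟨rfl, rfl⟩⟩, ?_⟩
        rintro y ⟨e', ⟨h, rfl⟩ | ⟨rfl, h⟩⟩
        · cases h
        · rw [hf (Sum.inr_injective h)]
    · exact fun e => Or.inl ⟨e, rfl⟩
  · rintro ⟨M, hM, hverts⟩
    have h : ∀ e, ∃ c, M.Adj (Sum.inl e) (Sum.inr c) := by
      intro e
      obtain ⟨y, hy, -⟩ := hM (hverts e)
      obtain e' | c := y
      · exact (M.adj_sub hy).elim
      · exact ⟨c, hy⟩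
    choose f hf using h
    refine ⟨f, fun e e' hee => ?_, fun e => M.adj_sub (hf e)⟩
    have h1 := (hf e).symm
    have h2 := (hf e').symm
    rw [hee] at h1
    exact Sum.inl_injective (hM.eq_of_adj_left h1 h2)

theorem not_hasDeficientSet_iff_hasCompleteMatching [Finite Vn] [Finite Vm]
    (G : MixedMultigraph Vn Vm E) : ¬ G.HasDeficientSet ↔ G.HasCompleteMatching := by
  classical
  cases nonempty_fintype Vn
  cases nonempty_fintype Vm
  have hall := Finset.all_card_le_biUnion_card_iff_exists_injective
    (fun e : E => ({c | nodeOfCopy c ∈ G.ends e} : Finset (Copies Vn Vm)))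
  rw [← exists_injective_iff_hasCompleteMatching]
  simp only [Finset.mem_filter, Finset.mem_univ, true_and] at hall
  rw [← hall]
  constructor
  · intro h S
    by_contra hlt
    refine h ⟨S, _, fun e he c hc => ?_, not_le.1 hlt⟩
    simpa using ⟨e, he, hc⟩
  · rintro h ⟨S, T, hST, hcard⟩
    refine absurd ((h S).trans (Finset.card_le_card fun c hc => ?_)) (not_le.2 hcard)
    obtain ⟨e, he, hc⟩ : ∃ e ∈ S, nodeOfCopy c ∈ G.ends e := by simpa using hc
    exact hST e he c hc

end MixedMultigraph

/-! ### Generic points and row independence -/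

section Generic

open Matrix

/-- Row rank equals column rank. Independence is used below in this form: every load on the edges is
produced by some velocities. -/
theorem Matrix.linearIndependent_row_iff_mulVec_surjective {m n : Type*} [Fintype m] [Fintype n]
    (M : Matrix m n ℝ) : LinearIndependent ℝ M.row ↔ Function.Surjective M.mulVec := by
  rw [← M.coe_mulVecLin, ← LinearMap.range_eq_top]
  constructor
  · intro h
    apply Submodule.eq_top_of_finrank_eq
    rw [← Matrix.rank, h.rank_matrix, Module.finrank_fintype_fun_eq_card]
  · intro h
    rw [linearIndependent_iff_card_eq_finrank_span, Set.finrank, ← Matrix.rank_eq_finrank_span_row,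
      Matrix.rank, h, finrank_top, Module.finrank_fintype_fun_eq_card]

/-- Over the reals the Gram matrix has the same rank. This turns independence into the non-vanishing
of a single polynomial in the entries. -/
theorem Matrix.linearIndependent_row_iff_det_mul_transpose_ne_zero {m n : Type*} [Fintype m]
    [DecidableEq m] [Fintype n] (M : Matrix m n ℝ) :
    LinearIndependent ℝ M.row ↔ (M * Mᵀ).det ≠ 0 := by
  rw [linearIndependent_iff_card_eq_finrank_span, Set.finrank, ← Matrix.rank_eq_finrank_span_row,
    ← Matrix.rank_self_mul_transpose, Matrix.rank_eq_finrank_span_row,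
    ← Set.finrank, ← linearIndependent_iff_card_eq_finrank_span,
    Matrix.linearIndependent_rows_iff_isUnit, Matrix.isUnit_iff_isUnit_det, isUnit_iff_ne_zero]

/-- Rows with polynomial entries that are independent at some real point are independent at every
point with algebraically independent coordinates. -/
theorem AlgebraicIndependent.linearIndependent_row {σ m n : Type*} [Finite m] [Finite n]
    (M : Matrix m n (MvPolynomial σ ℚ)) {p q : σ → ℝ} (hp : AlgebraicIndependent ℚ p)
    (hq : LinearIndependent ℝ (M.map (MvPolynomial.aeval q)).row) :
    LinearIndependent ℝ (M.map (MvPolynomial.aeval p)).row := by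
  classical
  cases nonempty_fintype m
  cases nonempty_fintype n
  have key : ∀ x : σ → ℝ, ((M.map (MvPolynomial.aeval x)) * (M.map (MvPolynomial.aeval x))ᵀ).det =
      MvPolynomial.aeval x ((M * Mᵀ).det) := by
    intro x
    rw [AlgHom.map_det, AlgHom.mapMatrix_apply, Matrix.map_mul, Matrix.transpose_map]
  rw [Matrix.linearIndependent_row_iff_det_mul_transpose_ne_zero, key] at hq ⊢
  intro h
  apply hq
  rw [(injective_iff_map_eq_zero _).1 hp _ h, map_zero]

theorem exists_algebraicIndependent_real (σ : Type*) [Finite σ] :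
    ∃ p : σ → ℝ, AlgebraicIndependent ℚ p := by
  obtain ⟨s, hs⟩ := exists_isTranscendenceBasis ℚ ℝ
  -- With a finite transcendence basis the reals would be algebraic over a countable ring, hence
  -- countable.
  have hinf : Infinite s := by
    by_contra hfin
    rw [not_infinite_iff_finite] at hfin
    have : Algebra.IsAlgebraic (Algebra.adjoin ℚ (Set.range ((↑) : s → ℝ))) ℝ := hs.isAlgebraic
    have hle := Algebra.IsAlgebraic.cardinalMk_le_max
      (Algebra.adjoin ℚ (Set.range ((↑) : s → ℝ))) ℝ
    have hadj : Cardinal.mk (Algebra.adjoin ℚ (Set.range ((↑) : s → ℝ))) ≤ Cardinal.aleph0 := by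
      refine (Cardinal.mk_le_of_injective hs.1.aevalEquiv.symm.injective).trans
        (MvPolynomial.cardinalMk_le_max.trans ?_)
      simp
    rw [max_eq_right hadj, Cardinal.mk_real] at hle
    exact absurd hle (not_le.2 Cardinal.aleph0_lt_continuum)
  cases nonempty_fintype σ
  obtain ⟨f⟩ : Nonempty (σ ↪ s) := by
    exact ⟨(Fintype.equivFin σ).toEmbedding.trans
      (Fin.valEmbedding.trans (Infinite.natEmbedding s))⟩
  exact ⟨_, hs.1.comp f f.injective⟩

end Generic

/-! ### Rado's theorem for subspaces -/

section Rado

open Module Submodule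

variable {K V ι : Type*} [Field K] [AddCommGroup V] [Module K V]

/-- Split off a line and intersect a complement of it with `A`; the modular law gives the sum. This
is the shrinking step in the proof of Rado's theorem. -/
theorem Submodule.exists_proper_sup_eq {A : Submodule K V} (hA : 2 ≤ finrank K A) :
    ∃ B C : Submodule K V, B < A ∧ C < A ∧ B ⊔ C = A := by
  obtain ⟨x, hxA, hx⟩ : ∃ x ∈ A, x ≠ 0 := by
    by_contra! h
    have : A = ⊥ := (Submodule.eq_bot_iff A).2 h
    rw [this, finrank_bot] at hA
    omega
  obtain ⟨C, hC⟩ := exists_isCompl (span K {x})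
  have hle : span K {x} ≤ A := by simpa using hxA
  refine ⟨span K {x}, C ⊓ A, lt_of_le_of_ne hle ?_, lt_of_le_of_ne inf_le_right ?_, ?_⟩
  · intro h
    rw [← h, finrank_span_singleton hx] at hA
    omega
  · intro h
    have h1 : x ∈ C ⊓ A := by rw [h]; exact hxA
    have h2 : x ∈ span K {x} ⊓ C := ⟨mem_span_singleton_self x, h1.1⟩
    rw [hC.inf_eq_bot] at h2
    exact hx (by simpa using h2)
  · rw [← sup_inf_assoc_of_le C hle, hC.sup_eq_top, top_inf_eq]

/-- **Rado's theorem** for subspaces: a finite family of subspaces has a linearly independent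
transversal as soon as the span of any `k` members has dimension at least `k`. -/
theorem Submodule.exists_linearIndependent_transversal [FiniteDimensional K V] [Finite ι]
    (A : ι → Submodule K V)
    (hA : ∀ F : Finset ι, F.card ≤ finrank K (F.sup A : Submodule K V)) :
    ∃ x : ι → V, (∀ i, x i ∈ A i) ∧ LinearIndependent K x := by
  classical
  cases nonempty_fintype ι
  induction hN : ∑ i, finrank K (A i) using Nat.strong_induction_on generalizing A with
  | _ N ih =>
  by_cases hdim : ∃ i, 2 ≤ finrank K (A i)
  · obtain ⟨i, hi⟩ := hdim
    obtain ⟨B, C, hB, hC, hBC⟩ := exists_proper_sup_eq hi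
    have descend : ∀ D < A i,
        (∀ F : Finset ι, F.card ≤ finrank K (F.sup (Function.update A i D) : Submodule K V)) →
        ∃ x : ι → V, (∀ i, x i ∈ A i) ∧ LinearIndependent K x := by
      intro D hD hF
      have hle : ∀ j, Function.update A i D j ≤ A j := by
        intro j
        by_cases hj : j = i
        · subst hj; simpa using hD.le
        · simp [hj]
      obtain ⟨x, hx, hli⟩ := ih _ (by
        rw [← hN]
        refine Finset.sum_lt_sum (fun j _ => finrank_mono (hle j)) ⟨i, Finset.mem_univ _, ?_⟩
        rw [Function.update_self]
        exact finrank_lt_finrank_of_lt hD) _ hF rfl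
      exact ⟨x, fun j => hle j (hx j), hli⟩
    -- If shrinking `A i` to `D` breaks the condition, it breaks at a set containing `i`; removing
    -- `i` leaves a tight witness.
    have bad : ∀ D : Submodule K V,
        (¬ ∀ F : Finset ι, F.card ≤ finrank K (F.sup (Function.update A i D) : Submodule K V)) →
        ∃ F : Finset ι, i ∉ F ∧ finrank K (D ⊔ F.sup A : Submodule K V) ≤ F.card := by
      intro D hD
      push Not at hD
      obtain ⟨F, hF⟩ := hD
      have hsup : ∀ F' : Finset ι, i ∉ F' → F'.sup (Function.update A i D) = F'.sup A := by
        intro F' hi'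
        refine Finset.sup_congr rfl fun j hj => Function.update_of_ne ?_ _ _
        rintro rfl
        exact hi' hj
      by_cases hiF : i ∈ F
      · refine ⟨F.erase i, Finset.notMem_erase i F, ?_⟩
        rw [← Finset.insert_erase hiF, Finset.sup_insert, Function.update_self,
          hsup _ (Finset.notMem_erase i F), Finset.card_insert_of_notMem
          (Finset.notMem_erase i F)] at hF
        omega
      · rw [hsup F hiF] at hF
        exact absurd (hA F) (not_le.2 hF)
    by_cases hB' : ∀ F : Finset ι,
        F.card ≤ finrank K (F.sup (Function.update A i B) : Submodule K V)
    · exact descend B hB hB'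
    by_cases hC' : ∀ F : Finset ι,
        F.card ≤ finrank K (F.sup (Function.update A i C) : Submodule K V)
    · exact descend C hC hC'
    exfalso
    obtain ⟨F, hiF, hF⟩ := bad B hB'
    obtain ⟨F', hiF', hF'⟩ := bad C hC'
    -- Submodularity of dimension: the two witnesses bound the sum by `|F| + |F'|`, while the
    -- hypothesis gives at least `|F ∪ F'| + 1` for the join, as `B ⊔ C = A i`, and `|F ∩ F'|` for
    -- the meet.
    have h1 := finrank_sup_add_finrank_inf_eq (B ⊔ F.sup A) (C ⊔ F'.sup A)
    have h2 : (insert i (F ∪ F')).card ≤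
        finrank K ((B ⊔ F.sup A) ⊔ (C ⊔ F'.sup A) : Submodule K V) := by
      refine (hA _).trans (finrank_mono (le_of_eq ?_))
      rw [Finset.sup_insert, Finset.sup_union, sup_sup_sup_comm, hBC]
    have h3 : (F ∩ F').card ≤
        finrank K ((B ⊔ F.sup A) ⊓ (C ⊔ F'.sup A) : Submodule K V) := by
      refine (hA _).trans (finrank_mono (le_inf ?_ ?_))
      · exact (Finset.sup_mono Finset.inter_subset_left).trans le_sup_right
      · exact (Finset.sup_mono Finset.inter_subset_right).trans le_sup_right
    rw [Finset.card_insert_of_notMem (by simp [hiF, hiF'])] at h2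
    have h4 := Finset.card_union_add_card_inter F F'
    omega
  · push Not at hdim
    have hone : ∀ i, ∃ x ∈ A i, x ≠ 0 := by
      intro i
      by_contra! h
      have h1 := hA {i}
      rw [Finset.sup_singleton, (Submodule.eq_bot_iff (A i)).2 h, finrank_bot] at h1
      simp at h1
    choose x hxA hx using hone
    have hspan : ∀ i, A i = span K {x i} := by
      intro i
      symm
      apply Submodule.eq_of_le_of_finrank_le
      · simpa using hxA i
      · rw [finrank_span_singleton (hx i)]
        have := hdim i
        omega
    refine ⟨x, hxA, ?_⟩
    rw [linearIndependent_iff_card_le_finrank_span]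
    refine (hA Finset.univ).trans (finrank_mono ?_)
    refine Finset.sup_le fun i _ => ?_
    rw [hspan i]
    exact span_mono (by simp)

end Rado

/-! ### Edge directions and Laman's theorem -/

section EdgeMatrix

open Matrix Module Finset

/-- The matrix of a multigraph with edge directions: the row of the edge `e` has the entries `d e`
at the node `s e` and `- d e` at the node `t e`. -/
def edgeMatrix {X E : Type*} [DecidableEq X] (s t : E → X) (d : E → Fin 2 → ℝ) :
    Matrix E (X × Fin 2) ℝ :=
  Matrix.of fun e c => ((if s e = c.1 then 1 else 0) - (if t e = c.1 then 1 else 0)) * d e c.2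

variable {X E : Type*} [DecidableEq X]

theorem edgeMatrix_mulVec [Fintype X] (s t : E → X) (d : E → Fin 2 → ℝ) (p : X × Fin 2 → ℝ)
    (e : E) : (edgeMatrix s t d *ᵥ p) e =
      d e 0 * (p (s e, 0) - p (t e, 0)) + d e 1 * (p (s e, 1) - p (t e, 1)) := by
  simp only [edgeMatrix, mulVec, dotProduct, of_apply, Fintype.sum_prod_type_right,
    Fin.sum_univ_two, sub_mul, ite_mul, one_mul, zero_mul, Finset.sum_sub_distrib,
    Finset.sum_ite_eq, Finset.mem_univ, if_true]
  ring

/-- This is Rado's condition. Once each edge of `F` has all directions available, the kernel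
consists of functions constant on the connected components of `F`, so the rank is at least `2(|X| -
c)` for `c` components; summing sparsity over the components gives `#F ≤ 2(|X| - c)`. -/
theorem card_le_finrank_of_sparse [Fintype X] [Finite E] (s t : E → X) (F : Finset E)
    (h : ∀ W : Finset X, W.Nonempty → #{e ∈ F | s e ∈ W ∧ t e ∈ W} + 2 ≤ 2 * #W)
    (S : Submodule ℝ (X × Fin 2 → ℝ))
    (hS : ∀ e ∈ F, ∀ d : Fin 2 → ℝ, edgeMatrix s t (fun _ => d) e ∈ S) : #F ≤ finrank ℝ S := by
  classical
  let r : X → X → Prop := fun u v => ∃ e ∈ F, s e = u ∧ t e = v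
  let Q := Quot r
  let mk : X → Q := Quot.mk r
  have : Finite Q := Finite.of_surjective mk Quot.mk_surjective
  cases nonempty_fintype Q
  have hmk : ∀ e ∈ F, mk (s e) = mk (t e) := fun e he => Quot.sound ⟨e, he, rfl, rfl⟩
  have hcount : #F + 2 * Fintype.card Q ≤ 2 * Fintype.card X := by
    have h1 : #F = ∑ q : Q, #{e ∈ F | mk (s e) = q} :=
      Finset.card_eq_sum_card_fiberwise (fun _ _ => Finset.mem_coe.2 (mem_univ _))
    have h2 : Fintype.card X = ∑ q : Q, #{x | mk x = q} :=
      Finset.card_eq_sum_card_fiberwise (fun _ _ => Finset.mem_coe.2 (mem_univ _))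
    have h3 : ∑ q : Q, (#{e ∈ F | mk (s e) = q} + 2) ≤ ∑ q : Q, 2 * #{x | mk x = q} := by
      refine Finset.sum_le_sum fun q _ => ?_
      obtain ⟨x, hx⟩ := Quot.mk_surjective q
      refine le_trans ?_ (h {x | mk x = q} ⟨x, by simpa using hx⟩)
      refine Nat.add_le_add_right (card_le_card fun e he => ?_) 2
      simp only [mem_filter, mem_univ, true_and] at he ⊢
      exact ⟨he.1, he.2, (hmk e he.1) ▸ he.2⟩
    rw [Finset.sum_add_distrib, ← h1, ← Finset.mul_sum, ← h2] at h3
    simp at h3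
    omega
  let M : Matrix (F × Fin 2) (X × Fin 2) ℝ :=
    Matrix.of fun i => edgeMatrix s t (fun _ => Pi.single i.2 1) i.1
  have hrow : finrank ℝ (LinearMap.range M.mulVecLin) ≤ finrank ℝ S := by
    have : M.rank ≤ finrank ℝ S := by
      rw [Matrix.rank_eq_finrank_span_row]
      refine Submodule.finrank_mono (Submodule.span_le.2 ?_)
      rintro _ ⟨i, rfl⟩
      exact hS i.1 i.1.2 _
    exact this
  have hker : finrank ℝ (LinearMap.ker M.mulVecLin) ≤ 2 * Fintype.card Q := by
    let L : (Q × Fin 2 → ℝ) →ₗ[ℝ] (X × Fin 2 → ℝ) := LinearMap.funLeft ℝ ℝ (Prod.map mk id)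
    have hle : LinearMap.ker M.mulVecLin ≤ LinearMap.range L := by
      intro p hp
      have hp' : ∀ e ∈ F, ∀ k, p (s e, k) = p (t e, k) := by
        intro e he k
        have h1 : (edgeMatrix s t (fun _ => Pi.single k 1) *ᵥ p) e = 0 :=
          congrFun (LinearMap.mem_ker.1 hp) (⟨e, he⟩, k)
        rw [edgeMatrix_mulVec] at h1
        fin_cases k <;> simpa [sub_eq_zero] using h1
      refine ⟨fun c => Quot.lift (fun x => p (x, c.2)) ?_ c.1, rfl⟩
      rintro _ _ ⟨e, he, rfl, rfl⟩
      exact hp' e he c.2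
    refine (Submodule.finrank_mono hle).trans ((LinearMap.finrank_range_le L).trans ?_)
    simp [mul_comm]
  have hsum := M.mulVecLin.finrank_range_add_finrank_ker
  rw [finrank_fintype_fun_eq_card, Fintype.card_prod, Fintype.card_fin] at hsum
  omega

/-- A `(2,2)`-sparse multigraph has edge directions that make its rows independent. -/
theorem exists_directions_of_sparse [Fintype X] [Fintype E] (s t : E → X)
    (h : ∀ W : Finset X, W.Nonempty → #{e | s e ∈ W ∧ t e ∈ W} + 2 ≤ 2 * #W) :
    ∃ d : E → Fin 2 → ℝ, LinearIndependent ℝ (edgeMatrix s t d).row := by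
  classical
  -- `A e` is the space of all possible rows of `e`, one for each direction; a transversal is a
  -- choice of directions.
  let A : E → Submodule ℝ (X × Fin 2 → ℝ) := fun e =>
    LinearMap.range (LinearMap.pi fun c : X × Fin 2 =>
      (((if s e = c.1 then 1 else 0) - (if t e = c.1 then 1 else 0) : ℝ)) •
        (LinearMap.proj c.2 : (Fin 2 → ℝ) →ₗ[ℝ] ℝ))
  obtain ⟨x, hx, hli⟩ := Submodule.exists_linearIndependent_transversal A (fun F => by
    refine card_le_finrank_of_sparse s t F (fun W hW => ?_) _ (fun e he d => ?_)
    · refine le_trans (Nat.add_le_add_right (card_le_card ?_) 2) (h W hW)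
      exact Finset.filter_subset_filter _ (subset_univ F)
    · exact Finset.le_sup (f := A) he ⟨d, rfl⟩)
  choose d hd using hx
  refine ⟨d, ?_⟩
  have : (edgeMatrix s t d).row = x := by
    funext e
    rw [← hd e]
    rfl
  rwa [this]

theorem linearIndependent_edgeMatrix_of_generic [Fintype X] [Fintype E] (s t : E → X)
    (h : ∀ W : Finset X, W.Nonempty → #{e | s e ∈ W ∧ t e ∈ W} + 2 ≤ 2 * #W)
    (d : E → Fin 2 → ℝ) (hd : AlgebraicIndependent ℚ (fun i : E × Fin 2 => d i.1 i.2)) :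
    LinearIndependent ℝ (edgeMatrix s t d).row := by
  obtain ⟨d', hd'⟩ := exists_directions_of_sparse s t h
  let M : Matrix E (X × Fin 2) (MvPolynomial (E × Fin 2) ℚ) := Matrix.of fun e c =>
    ((if s e = c.1 then 1 else 0) - (if t e = c.1 then 1 else 0)) * MvPolynomial.X (e, c.2)
  have hM : ∀ d : E → Fin 2 → ℝ,
      M.map (MvPolynomial.aeval (fun i : E × Fin 2 => d i.1 i.2)) = edgeMatrix s t d := by
    intro d
    ext e c
    simp only [M, edgeMatrix, Matrix.map_apply, of_apply, map_mul, map_sub, MvPolynomial.aeval_X,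
      apply_ite (MvPolynomial.aeval (fun i : E × Fin 2 => d i.1 i.2)), map_one, map_zero]
  rw [← hM] at hd' ⊢
  exact hd.linearIndependent_row M hd'

/-- **Laman's theorem**, sufficiency: a `(2,3)`-sparse multigraph has a placement in the plane at
which the rows of its rigidity matrix are independent. -/
theorem exists_placement_of_sparse [Fintype X] [Fintype E] (s t : E → X)
    (h : ∀ W : Finset X, (∃ e, s e ∈ W ∧ t e ∈ W) → #{e | s e ∈ W ∧ t e ∈ W} + 3 ≤ 2 * #W) :
    ∃ q : X → Fin 2 → ℝ,
      LinearIndependent ℝ (edgeMatrix s t (fun e => q (s e) - q (t e))).row := by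
  classical
  -- The extra `Unit` index is a direction for the duplicate of an edge. One generic choice serves
  -- whichever edge is doubled.
  obtain ⟨d₀, hd₀⟩ := exists_algebraicIndependent_real ((E ⊕ Unit) × Fin 2)
  let d' : E ⊕ Unit → Fin 2 → ℝ := fun e k => d₀ (e, k)
  let d : E → Fin 2 → ℝ := fun e => d' (Sum.inl e)
  have hdouble : ∀ e₀ : E, LinearIndependent ℝ
      (edgeMatrix (Sum.elim s fun _ => s e₀) (Sum.elim t fun _ => t e₀) d').row := by
    intro e₀
    refine linearIndependent_edgeMatrix_of_generic _ _ (fun W hW => ?_) d' hd₀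
    have hsplit : #{e : E ⊕ Unit | Sum.elim s (fun _ => s e₀) e ∈ W ∧
        Sum.elim t (fun _ => t e₀) e ∈ W} =
        #{e | s e ∈ W ∧ t e ∈ W} + if s e₀ ∈ W ∧ t e₀ ∈ W then 1 else 0 := by
      simp only [Finset.card_filter, Fintype.sum_sum_type, Sum.elim_inl, Sum.elim_inr,
        Finset.univ_unique, Finset.sum_singleton]
      rfl
    rw [hsplit]
    by_cases hex : ∃ e, s e ∈ W ∧ t e ∈ W
    · have := h W hex
      split_ifs <;> omega
    · have h1 : #{e | s e ∈ W ∧ t e ∈ W} = 0 := by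
        rw [card_eq_zero, filter_eq_empty_iff]
        exact fun e _ he => hex ⟨e, he⟩
      rw [h1, if_neg fun he => hex ⟨e₀, he⟩]
      have := hW.card_pos
      omega
  have hd : LinearIndependent ℝ (edgeMatrix s t d).row := by
    rcases isEmpty_or_nonempty E with hE | ⟨⟨e₀⟩⟩
    · exact linearIndependent_empty_type
    · exact (hdouble e₀).comp Sum.inl Sum.inl_injective
  let N := LinearMap.ker (edgeMatrix s t d).mulVecLin
  have hN : ∀ p ∈ N, ∀ e,
      d e 0 * (p (s e, 0) - p (t e, 0)) + d e 1 * (p (s e, 1) - p (t e, 1)) = 0 := by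
    intro p hp e
    rw [← edgeMatrix_mulVec]
    exact congrFun (LinearMap.mem_ker.1 hp) e
  -- A unit load on the duplicate of `e₀` alone is solvable; the solution lies in `N` and must
  -- separate the ends of `e₀`.
  have hproper : ∀ e₀, ∃ p ∈ N, ∃ k, p (s e₀, k) ≠ p (t e₀, k) := by
    intro e₀
    obtain ⟨p, hp⟩ := (Matrix.linearIndependent_row_iff_mulVec_surjective _).1 (hdouble e₀)
      (Pi.single (Sum.inr ()) 1)
    refine ⟨p, ?_, ?_⟩
    · refine LinearMap.mem_ker.2 (funext fun e => ?_)
      have h1 := congrFun hp (Sum.inl e)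
      rw [edgeMatrix_mulVec, Pi.single_eq_of_ne (by simp)] at h1
      rw [mulVecLin_apply, edgeMatrix_mulVec]
      exact h1
    · by_contra! hk
      have h1 := congrFun hp (Sum.inr ())
      rw [edgeMatrix_mulVec, Pi.single_eq_same] at h1
      simp [hk] at h1
  -- A real vector space is not a finite union of proper subspaces, so one `p` separates the ends of
  -- all edges.
  obtain ⟨p, hpN, hp⟩ : ∃ p ∈ N, ∀ e, ∃ k, p (s e, k) ≠ p (t e, k) := by
    let U : E → Submodule ℝ N := fun e => LinearMap.ker
      ((LinearMap.pi fun k : Fin 2 => (LinearMap.proj (s e, k) : (X × Fin 2 → ℝ) →ₗ[ℝ] ℝ) -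
        LinearMap.proj (t e, k)) ∘ₗ N.subtype)
    have hU : ∀ e (p : N), p ∈ U e ↔ ∀ k, p.1 (s e, k) = p.1 (t e, k) := by
      intro e p
      simp [U, LinearMap.mem_ker, funext_iff, sub_eq_zero]
    have htop : ⊤ ∉ Finset.univ.image U := by
      intro htop
      obtain ⟨e, -, he⟩ := Finset.mem_image.1 htop
      obtain ⟨p, hpN, k, hk⟩ := hproper e
      exact hk ((hU e ⟨p, hpN⟩).1 (he ▸ Submodule.mem_top) k)
    obtain ⟨p, hp⟩ := (Set.ne_univ_iff_exists_notMem _).1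
      (Subspace.biUnion_ne_univ_of_top_notMem htop)
    refine ⟨p.1, p.2, fun e => ?_⟩
    by_contra! hk
    exact hp (Set.mem_biUnion (Finset.mem_coe.2 (Finset.mem_image_of_mem U (mem_univ e)))
      ((hU e p).2 hk))
  -- Differences of `p` along edges are orthogonal to `d`; after a quarter turn they are parallel to
  -- it, so the rows at `q` are nonzero multiples of independent rows.
  let q : X → Fin 2 → ℝ := fun x => ![- p (x, 1), p (x, 0)]
  have hscale : ∀ e, ∃ c : ℝˣ, q (s e) - q (t e) = (c : ℝ) • d e := by
    intro e
    have h1 := hN p hpN e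
    have hd0 : d e 0 ≠ 0 := hd₀.ne_zero (Sum.inl e, 0)
    have hw : p (s e, 1) - p (t e, 1) ≠ 0 := by
      intro hw
      obtain ⟨k, hk⟩ := hp e
      rw [hw, mul_zero, add_zero, mul_eq_zero, or_iff_right hd0] at h1
      fin_cases k
      · exact hk (sub_eq_zero.1 h1)
      · exact hk (sub_eq_zero.1 hw)
    refine ⟨Units.mk0 (-(p (s e, 1) - p (t e, 1)) / d e 0) (div_ne_zero (neg_ne_zero.2 hw) hd0),
      ?_⟩
    ext k
    fin_cases k
    · simp [q]
      field_simp
      ring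
    · simp [q]
      field_simp
      linarith
  choose c hc using hscale
  refine ⟨q, ?_⟩
  have hrow : (edgeMatrix s t (fun e => q (s e) - q (t e))).row =
      fun e => c e • (edgeMatrix s t d).row e := by
    funext e x
    simp only [edgeMatrix, Matrix.row, of_apply, hc, Pi.smul_apply, smul_eq_mul, Units.smul_def]
    ring
  rw [hrow]
  exact hd.units_smul c

end EdgeMatrix

/-! ### Rigid motions and the necessary count -/

namespace BodyBarGraph

open Matrix Module Finset

variable {Vn Vm J E : Type*}

/-- The pairing of the velocity of the node `v` with a line-bound vector, where point-like bodies
have no angular velocity. -/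
def nodePairing (x : (Vn × Fin 3) ⊕ (Vm × Fin 2) → ℝ) (L : Fin 3 → ℝ) : Vn ⊕ Vm → ℝ
  | Sum.inl a => ∑ k, L k * x (Sum.inl (a, k))
  | Sum.inr v => ∑ k : Fin 2, L k.castSucc * x (Sum.inr (v, k))

theorem rigidityMatrix_mulVec [Fintype Vn] [Fintype Vm] (G : BodyBarGraph Vn Vm J E)
    (p : Vm ⊕ J → Fin 2 → ℝ) (x : (Vn × Fin 3) ⊕ (Vm × Fin 2) → ℝ) (e : E) :
    (G.rigidityMatrix p *ᵥ x) e =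
      nodePairing x (lineBound (p (G.fst e)) (p (G.snd e))) (G.node (G.fst e)) -
      nodePairing x (lineBound (p (G.fst e)) (p (G.snd e))) (G.node (G.snd e)) := by
  classical
  set L := lineBound (p (G.fst e)) (p (G.snd e)) with hL
  have hsum : ∀ w : Vn ⊕ Vm,
      ∑ v, (if w = v then 1 else 0) * nodePairing x L v = nodePairing x L w := by
    intro w
    simp
  calc (G.rigidityMatrix p *ᵥ x) e
      = ∑ v, G.incidence e v * nodePairing x L v := by
        simp only [mulVec, dotProduct, rigidityMatrix, of_apply, Fintype.sum_sum_type,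
          Fintype.sum_prod_type, nodePairing, Finset.mul_sum, mul_assoc, hL]
    _ = _ := by
        simp only [incidence, sub_mul, Finset.sum_sub_distrib]
        congr 1
        · convert hsum (G.node (G.fst e)) using 4
        · convert hsum (G.node (G.snd e)) using 4

theorem IndependentAt.node_fst_ne_node_snd {G : BodyBarGraph Vn Vm J E}
    {p : Vm ⊕ J → Fin 2 → ℝ} (h : G.IndependentAt p) (e : E) :
    G.node (G.fst e) ≠ G.node (G.snd e) := by
  classical
  intro heq
  have hinc : ∀ v, G.incidence e v = 0 := fun v =>
    sub_eq_zero.2 (if_congr (by rw [heq]) rfl rfl)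
  apply h.ne_zero e
  ext (⟨a, k⟩ | ⟨v, k⟩) <;> simp [Matrix.row, rigidityMatrix, hinc]

/-- The velocities of all bodies in the rigid motion of the plane with velocity `(m 0, m 1)` at the
origin and angular velocity `m 2`. -/
def rigidMotion (p : Vm ⊕ J → Fin 2 → ℝ) :
    (Fin 3 → ℝ) →ₗ[ℝ] ((Vn × Fin 3) ⊕ (Vm × Fin 2) → ℝ) where
  toFun m := Sum.elim (fun c => m c.2)
    (fun c => m c.2.castSucc + m 2 * ![- p (Sum.inl c.1) 1, p (Sum.inl c.1) 0] c.2)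
  map_add' m m' := by
    ext (c | c)
    · rfl
    · simp only [Sum.elim_inr, Pi.add_apply]
      ring
  map_smul' r m := by
    ext (c | c)
    · rfl
    · simp only [Sum.elim_inr, Pi.smul_apply, smul_eq_mul, RingHom.id_apply]
      ring

/-- The condition `hL` says that the line of `L` passes through the site. The pairing then does not
depend on the node, so the two ends of a bar cancel. -/
theorem nodePairing_rigidMotion (G : BodyBarGraph Vn Vm J E) (p : Vm ⊕ J → Fin 2 → ℝ)
    (m : Fin 3 → ℝ) (L : Fin 3 → ℝ) (i : Vm ⊕ J) (hL : L 2 = L 1 * p i 0 - L 0 * p i 1) :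
    nodePairing (rigidMotion (Vn := Vn) p m) L (G.node i) = ∑ k, L k * m k := by
  rcases i with v | j
  · simp [nodePairing, rigidMotion, node, Fin.sum_univ_two, Fin.sum_univ_three, hL]
    ring
  · simp [nodePairing, rigidMotion, node]

theorem lineBound_two_eq_left (x y : Fin 2 → ℝ) :
    lineBound x y 2 = lineBound x y 1 * x 0 - lineBound x y 0 * x 1 := by
  simp [lineBound]
  ring

theorem lineBound_two_eq_right (x y : Fin 2 → ℝ) :
    lineBound x y 2 = lineBound x y 1 * y 0 - lineBound x y 0 * y 1 := by
  simp [lineBound]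
  ring

theorem rigidityMatrix_mulVec_rigidMotion [Fintype Vn] [Fintype Vm] (G : BodyBarGraph Vn Vm J E)
    (p : Vm ⊕ J → Fin 2 → ℝ) (m : Fin 3 → ℝ) : G.rigidityMatrix p *ᵥ rigidMotion p m = 0 := by
  ext e
  rw [rigidityMatrix_mulVec, nodePairing_rigidMotion _ _ _ _ _ (lineBound_two_eq_left _ _),
    nodePairing_rigidMotion _ _ _ _ _ (lineBound_two_eq_right _ _), sub_self, Pi.zero_apply]

/-- The necessary count: independent bars whose ends lie on the bodies `A` and the points `P`
number at most `3|A| + 2|P| - 3`. -/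
theorem IndependentAt.card_add_three_le [Finite Vn] [Finite Vm] [Finite E]
    {G : BodyBarGraph Vn Vm J E} {p : Vm ⊕ J → Fin 2 → ℝ} (h : G.IndependentAt p)
    (hp : IsGeneric p) (A : Finset Vn) (P : Finset Vm) (F : Finset E) (hF : F.Nonempty)
    (hends : ∀ e ∈ F, Sum.elim (· ∈ A) (· ∈ P) (G.node (G.fst e)) ∧
      Sum.elim (· ∈ A) (· ∈ P) (G.node (G.snd e))) :
    #F + 3 ≤ 3 * #A + 2 * #P := by
  classical
  cases nonempty_fintype Vn
  cases nonempty_fintype Vm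
  cases nonempty_fintype E
  let ι : (A × Fin 3) ⊕ (P × Fin 2) → (Vn × Fin 3) ⊕ (Vm × Fin 2) :=
    Sum.map (Prod.map Subtype.val id) (Prod.map Subtype.val id)
  have hι : Function.Injective ι :=
    (Subtype.val_injective.prodMap Function.injective_id).sumMap
      (Subtype.val_injective.prodMap Function.injective_id)
  -- The submatrix with rows `F` and columns at the nodes of `A` and `P`.
  let Φ : ((A × Fin 3) ⊕ (P × Fin 2) → ℝ) →ₗ[ℝ] (F → ℝ) :=
    LinearMap.funLeft ℝ ℝ Subtype.val ∘ₗ (G.rigidityMatrix p).mulVecLin ∘ₗ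
      Function.ExtendByZero.linearMap ℝ ι
  have hpair : ∀ (x : (Vn × Fin 3) ⊕ (Vm × Fin 2) → ℝ) (L : Fin 3 → ℝ) (v : Vn ⊕ Vm),
      Sum.elim (· ∈ A) (· ∈ P) v →
      nodePairing (Function.extend ι (x ∘ ι) 0) L v = nodePairing x L v := by
    rintro x L (a | v) hv
    · refine Finset.sum_congr rfl fun k _ => ?_
      exact congrArg _ (hι.extend_apply (x ∘ ι) 0 (Sum.inl (⟨a, hv⟩, k)))
    · refine Finset.sum_congr rfl fun k _ => ?_
      exact congrArg _ (hι.extend_apply (x ∘ ι) 0 (Sum.inr (⟨v, hv⟩, k)))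
  have hΦ : ∀ (x : (Vn × Fin 3) ⊕ (Vm × Fin 2) → ℝ) (e : F),
      Φ (x ∘ ι) e = (G.rigidityMatrix p *ᵥ x) e := by
    intro x e
    change (G.rigidityMatrix p *ᵥ (Function.extend ι (x ∘ ι) 0)) e = _
    rw [rigidityMatrix_mulVec, rigidityMatrix_mulVec, hpair _ _ _ (hends e e.2).1,
      hpair _ _ _ (hends e e.2).2]
  have hsurj : LinearMap.range Φ = ⊤ := by
    rw [LinearMap.range_eq_top]
    intro b
    obtain ⟨x, hx⟩ := (Matrix.linearIndependent_row_iff_mulVec_surjective _).1 h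
      (Function.extend Subtype.val b 0)
    refine ⟨x ∘ ι, funext fun e => ?_⟩
    rw [hΦ, hx, Subtype.val_injective.extend_apply]
  let T : (Fin 3 → ℝ) →ₗ[ℝ] ((A × Fin 3) ⊕ (P × Fin 2) → ℝ) :=
    LinearMap.funLeft ℝ ℝ ι ∘ₗ rigidMotion p
  have hTker : LinearMap.range T ≤ LinearMap.ker Φ := by
    rintro _ ⟨m, rfl⟩
    refine LinearMap.mem_ker.2 (funext fun e => ?_)
    refine (hΦ (rigidMotion p m) e).trans ?_
    rw [rigidityMatrix_mulVec_rigidMotion]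
    rfl
  have hTinj : Function.Injective T := by
    rw [← LinearMap.ker_eq_bot, LinearMap.ker_eq_bot']
    intro m hm
    -- A non-trivial body displays all of `m`. Otherwise an edge of `F` supplies two different
    -- points, and genericity gives them different first coordinates, which forces the angular
    -- velocity to vanish.
    by_cases hA : A.Nonempty
    · obtain ⟨a, ha⟩ := hA
      ext k
      exact congrFun hm (Sum.inl (⟨a, ha⟩, k))
    · obtain ⟨e, he⟩ := hF
      have hne := h.node_fst_ne_node_snd e
      obtain ⟨h1, h2⟩ := hends e he
      rw [Finset.not_nonempty_iff_eq_empty] at hA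
      have hpt : ∀ w, Sum.elim (· ∈ A) (· ∈ P) w →
          ∃ v, ∃ _ : v ∈ P, w = Sum.inr v ∧ m 0 - m 2 * p (Sum.inl v) 1 = 0 ∧
            m 1 + m 2 * p (Sum.inl v) 0 = 0 := by
        rintro (a | v) hw
        · simp [hA] at hw
        · refine ⟨v, hw, rfl, ?_, ?_⟩
          · have := congrFun hm (Sum.inr (⟨v, hw⟩, 0))
            simpa [T, ι, rigidMotion, LinearMap.funLeft, ← sub_eq_add_neg] using this
          · have := congrFun hm (Sum.inr (⟨v, hw⟩, 1))
            simpa [T, ι, rigidMotion, LinearMap.funLeft] using this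
      obtain ⟨u, -, hu, hu0, hu1⟩ := hpt _ h1
      obtain ⟨w, -, hw, hw0, hw1⟩ := hpt _ h2
      have huw : p (Sum.inl u) 0 - p (Sum.inl w) 0 ≠ 0 := by
        rw [sub_ne_zero]
        intro heq
        have := AlgebraicIndependent.injective hp
          (a₁ := (Sum.inl u, 0)) (a₂ := (Sum.inl w, 0)) heq
        simp only [Prod.mk.injEq, Sum.inl.injEq, and_true] at this
        exact hne (by rw [hu, hw, this])
      have hm2 : m 2 = 0 := by
        have : m 2 * (p (Sum.inl u) 0 - p (Sum.inl w) 0) = 0 := by linarith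
        exact (mul_eq_zero.1 this).resolve_right huw
      rw [hm2] at hu0 hu1
      ext k
      fin_cases k
      · simpa using hu0
      · simpa using hu1
      · exact hm2
  have h1 := Φ.finrank_range_add_finrank_ker
  have h2 := Submodule.finrank_mono hTker
  rw [LinearMap.finrank_range_of_inj hTinj] at h2
  rw [hsurj, finrank_top] at h1
  simp only [finrank_fintype_fun_eq_card, Fintype.card_sum, Fintype.card_prod, Fintype.card_fin,
    Fintype.card_coe] at h1 h2
  omega

end BodyBarGraph

/-! ### Reduction of (2,3)-sparsity to minimum degree three -/

section MinDegree

open Finset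

/-- Deleting a vertex of degree at most 2 lowers the edge count by at most 2 and `2 * #W` by exactly
2. If no edge remains, at most two edges were present; they need `#W ≥ 3`, except for a single edge
on two vertices. -/
theorem sparse_of_three_le_degree {X E : Type*} [DecidableEq X] [Fintype E] (s t : E → X)
    (hloop : ∀ e, s e ≠ t e) (hpar : ∀ e f, s(s e, t e) = s(s f, t f) → e = f)
    (hmin : ∀ W : Finset X, (∃ e, s e ∈ W ∧ t e ∈ W) →
      (∀ w ∈ W, 3 ≤ #{e | (s e ∈ W ∧ t e ∈ W) ∧ (s e = w ∨ t e = w)}) →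
      #{e | s e ∈ W ∧ t e ∈ W} + 3 ≤ 2 * #W)
    (W : Finset X) (hW : ∃ e, s e ∈ W ∧ t e ∈ W) :
    #{e | s e ∈ W ∧ t e ∈ W} + 3 ≤ 2 * #W := by
  classical
  induction W using Finset.strongInduction with
  | _ W ih =>
  by_cases hdeg : ∀ w ∈ W, 3 ≤ #{e | (s e ∈ W ∧ t e ∈ W) ∧ (s e = w ∨ t e = w)}
  · exact hmin W hW hdeg
  push Not at hdeg
  obtain ⟨w, hw, hdeg⟩ := hdeg
  have hsplit : #{e | s e ∈ W ∧ t e ∈ W} ≤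
      #{e | (s e ∈ W ∧ t e ∈ W) ∧ (s e = w ∨ t e = w)} +
        #{e | s e ∈ W.erase w ∧ t e ∈ W.erase w} := by
    refine (card_le_card fun e he => ?_).trans (card_union_le _ _)
    simp only [mem_union, mem_filter, mem_univ, true_and, mem_erase] at he ⊢
    tauto
  have hcard := card_erase_add_one hw
  by_cases hex : ∃ e, s e ∈ W.erase w ∧ t e ∈ W.erase w
  · have := ih _ (erase_ssubset hw) hex
    omega
  · have hzero : #{e | s e ∈ W.erase w ∧ t e ∈ W.erase w} = 0 := by
      rw [card_eq_zero, filter_eq_empty_iff]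
      exact fun e _ he => hex ⟨e, he⟩
    obtain ⟨e, hse, hte⟩ := hW
    have hpairs : ∀ f, s f ∈ W ∧ t f ∈ W → ({s f, t f} : Finset X) ⊆ W := fun f hf =>
      insert_subset hf.1 (singleton_subset_iff.2 hf.2)
    have htwo : 2 ≤ #W := by
      rw [← card_pair (hloop e)]
      exact card_le_card (hpairs e ⟨hse, hte⟩)
    rcases htwo.eq_or_lt with h2 | h2
    · have heq : ∀ f, s f ∈ W ∧ t f ∈ W → ({s f, t f} : Finset X) = W := fun f hf =>
        eq_of_subset_of_card_le (hpairs f hf) (by rw [card_pair (hloop f)]; exact h2.ge)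
      have hone : #{e | s e ∈ W ∧ t e ∈ W} ≤ 1 := by
        refine card_le_one.2 fun f hf g hg => hpar f g ?_
        simp only [mem_filter, mem_univ, true_and] at hf hg
        have hfg := (heq f hf).trans (heq g hg).symm
        have hset : ({s f, t f} : Set X) = {s g, t g} := by
          rw [← Finset.coe_pair, ← Finset.coe_pair, hfg]
        rw [Sym2.eq_iff]
        exact Set.pair_eq_pair_iff.1 hset
      omega
    · omega

end MinDegree

/-! ### Sparsity of the frame graph -/

namespace BodyBarGraph

open Matrix Finset

variable {Vn Vm J E : Type*}

/-- The bars whose ends lie on the bodies `A` and the points `P` number at most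
`3|A| + 2|P| - 3`, unless there are none. -/
def IsSparse [Fintype E] (G : BodyBarGraph Vn Vm J E) : Prop :=
  ∀ (A : Finset Vn) (P : Finset Vm) (F : Finset E), F.Nonempty →
    (∀ e ∈ F, Sum.elim (· ∈ A) (· ∈ P) (G.node (G.fst e)) ∧
      Sum.elim (· ∈ A) (· ∈ P) (G.node (G.snd e))) →
    #F + 3 ≤ 3 * #A + 2 * #P

/-- First ends in the bar-joint graph in which every body `a` is replaced by a rigid framework: two
base points `(a, 0)` and `(a, 1)` joined by a bar, and two bars from each joint of `a` to the base
points. -/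
def frameFst (G : BodyBarGraph Vn Vm J E) :
    E ⊕ (Vn ⊕ (J × Fin 2)) → (Vm ⊕ J) ⊕ (Vn × Fin 2)
  | Sum.inl e => Sum.inl (G.fst e)
  | Sum.inr (Sum.inl a) => Sum.inr (a, 0)
  | Sum.inr (Sum.inr (j, _)) => Sum.inl (Sum.inr j)

/-- Second ends in the bar-joint graph described at `frameFst`. -/
def frameSnd (G : BodyBarGraph Vn Vm J E) :
    E ⊕ (Vn ⊕ (J × Fin 2)) → (Vm ⊕ J) ⊕ (Vn × Fin 2)
  | Sum.inl e => Sum.inl (G.snd e)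
  | Sum.inr (Sum.inl a) => Sum.inr (a, 1)
  | Sum.inr (Sum.inr (j, i)) => Sum.inr (G.body j, i)

theorem IsSparse.node_fst_ne_node_snd [Fintype E] {G : BodyBarGraph Vn Vm J E} (h : G.IsSparse)
    (e : E) : G.node (G.fst e) ≠ G.node (G.snd e) := by
  intro heq
  rcases hn : G.node (G.fst e) with a | v
  · have := h {a} ∅ {e} (singleton_nonempty e) (by simp [← heq, hn])
    simp at this
  · have := h ∅ {v} {e} (singleton_nonempty e) (by simp [← heq, hn])
    simp at this

theorem IsSparse.frameFst_ne_frameSnd [Fintype E] {G : BodyBarGraph Vn Vm J E} (h : G.IsSparse)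
    (e : E ⊕ (Vn ⊕ (J × Fin 2))) : G.frameFst e ≠ G.frameSnd e := by
  rcases e with e | a | ⟨j, i⟩
  · intro heq
    exact h.node_fst_ne_node_snd e (congrArg G.node (Sum.inl_injective heq))
  · simp [frameFst, frameSnd]
  · simp [frameFst, frameSnd]

/-- Generic incidence covers the case of a surface joint; two parallel bars between points would
violate the count, since `2 + 3 > 2 * 2`. -/
theorem IsSparse.eq_of_sites_eq [Fintype E] {G : BodyBarGraph Vn Vm J E} (h : G.IsSparse)
    (hG : G.GenericIncidence) {e f : E} (hef : G.sites e = G.sites f) : e = f := by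
  classical
  by_cases hj : ∃ j, Sum.inr j ∈ G.sites e
  · obtain ⟨j, hj⟩ := hj
    exact hG.eq_of_sites_eq e f j hj hef
  · push Not at hj
    by_contra hne
    have hpt : ∀ i ∈ G.sites e, ∃ v, i = Sum.inl v := by
      rintro (v | j) hi
      · exact ⟨v, rfl⟩
      · exact absurd hi (hj j)
    obtain ⟨u, hu⟩ := hpt _ (Sym2.mem_mk_left _ _)
    obtain ⟨w, hw⟩ := hpt _ (Sym2.mem_mk_right _ _)
    have hf : (Sum.inl u = G.fst f ∧ Sum.inl w = G.snd f) ∨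
        (Sum.inl u = G.snd f ∧ Sum.inl w = G.fst f) := by
      rw [sites, sites, hu, hw] at hef
      exact Sym2.eq_iff.1 hef
    have := h ∅ {u, w} {e, f} (insert_nonempty _ _) (by
      intro g hg
      rw [mem_insert, mem_singleton] at hg
      rcases hg with rfl | rfl
      · simp [hu, hw, node]
      · rcases hf with ⟨h1, h2⟩ | ⟨h1, h2⟩ <;> simp [← h1, ← h2, node])
    rw [card_pair hne] at this
    have h2 := card_le_two (a := u) (b := w)
    simp at this
    omega

theorem IsSparse.eq_of_frame_eq [Fintype E] {G : BodyBarGraph Vn Vm J E} (h : G.IsSparse)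
    (hG : G.GenericIncidence) (e f : E ⊕ (Vn ⊕ (J × Fin 2)))
    (hef : s(G.frameFst e, G.frameSnd e) = s(G.frameFst f, G.frameSnd f)) : e = f := by
  rcases e with e | a | ⟨j, i⟩ <;> rcases f with f | b | ⟨k, l⟩ <;>
    simp [frameFst, frameSnd] at hef
  · rw [h.eq_of_sites_eq hG (Sym2.eq_iff.2 hef)]
  · rw [hef]
  · rw [hef.1, hef.2.2]

theorem IsSparse.frame_sparse [Fintype Vn] [Fintype Vm] [Fintype J] [Fintype E]
    [DecidableEq Vn] [DecidableEq Vm] [DecidableEq J]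
    {G : BodyBarGraph Vn Vm J E} (h : G.IsSparse) (hG : G.GenericIncidence)
    (W : Finset ((Vm ⊕ J) ⊕ (Vn × Fin 2)))
    (hW : ∃ e, G.frameFst e ∈ W ∧ G.frameSnd e ∈ W) :
    #{e | G.frameFst e ∈ W ∧ G.frameSnd e ∈ W} + 3 ≤ 2 * #W := by
  classical
  refine sparse_of_three_le_degree _ _ h.frameFst_ne_frameSnd (h.eq_of_frame_eq hG) ?_ W hW
  clear hW W
  intro W hW hdeg
  let A : Finset Vn := {a | Sum.inr (a, 0) ∈ W ∨ Sum.inr (a, 1) ∈ W}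
  let P : Finset Vm := {v | Sum.inl (Sum.inl v) ∈ W}
  let F : Finset E := {e | Sum.inl (G.fst e) ∈ W ∧ Sum.inl (G.snd e) ∈ W}
  -- `τ a` and `β a` count the joints and the base points of `a` that lie in `W`.
  let τ : Vn → ℕ := fun a => ∑ j with G.body j = a, if Sum.inl (Sum.inr j) ∈ W then 1 else 0
  let β : Vn → ℕ := fun a =>
    (if Sum.inr (a, 0) ∈ W then 1 else 0) + if Sum.inr (a, 1) ∈ W then 1 else 0
  -- A joint without base points in `W` keeps only its external bars, at most two by generic
  -- incidence, against degree three.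
  have hbody : ∀ j, Sum.inl (Sum.inr j) ∈ W → G.body j ∈ A := by
    intro j hj
    by_contra hA
    have hA' : ∀ i : Fin 2, Sum.inr (G.body j, i) ∉ W := by
      simpa [A, Fin.forall_fin_two] using hA
    have hinc : #{e | Sum.inr j ∈ G.sites e} ≤ 2 := by
      have := hG.encard_le_two j
      rw [Set.encard_eq_coe_toFinset_card] at this
      have h2 : ({e | Sum.inr j ∈ G.sites e} : Set E).toFinset =
          ({e | Sum.inr j ∈ G.sites e} : Finset E) := by ext; simp
      rw [h2] at this
      exact_mod_cast this
    have hle : #{e | (G.frameFst e ∈ W ∧ G.frameSnd e ∈ W) ∧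
        (G.frameFst e = Sum.inl (Sum.inr j) ∨ G.frameSnd e = Sum.inl (Sum.inr j))} ≤ 2 := by
      refine le_trans (card_le_card (t := ({e | Sum.inr j ∈ G.sites e} : Finset E).image Sum.inl)
        ?_) (card_image_le.trans hinc)
      rintro (e | a | ⟨k, i⟩) he <;> replace he := (mem_filter.1 he).2
      · simp only [frameFst, frameSnd, Sum.inl.injEq] at he
        simpa [sites, Sym2.mem_iff] using he.2.imp Eq.symm Eq.symm
      · simp [frameFst, frameSnd] at he
      · simp only [frameFst, frameSnd, Sum.inl.injEq,
          Sum.inr.injEq, reduceCtorEq, or_false] at he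
        obtain ⟨⟨-, hk⟩, rfl⟩ := he
        exact absurd hk (hA' i)
    have := hdeg _ hj
    omega
  -- Besides the other base point, the neighbours of a base point are joints of its body.
  have hbase : ∀ a i, Sum.inr (a, i) ∈ W → 2 ≤ τ a := by
    intro a i ha
    have hle : #{e | (G.frameFst e ∈ W ∧ G.frameSnd e ∈ W) ∧
        (G.frameFst e = Sum.inr (a, i) ∨ G.frameSnd e = Sum.inr (a, i))} ≤ τ a + 1 := by
      have hτ : τ a = #{j | G.body j = a ∧ Sum.inl (Sum.inr j) ∈ W} := by
        simp only [τ, ← Finset.card_filter, filter_filter]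
      rw [hτ]
      refine (card_le_card (t := insert (Sum.inr (Sum.inl a))
        (({j | G.body j = a ∧ Sum.inl (Sum.inr j) ∈ W} : Finset J).image
          fun j => Sum.inr (Sum.inr (j, i)))) ?_).trans
        ((card_insert_le _ _).trans (Nat.add_le_add_right card_image_le 1))
      rintro (e | b | ⟨k, l⟩) he <;> replace he := (mem_filter.1 he).2
      · simp [frameFst, frameSnd] at he
      · simp only [frameFst, frameSnd, Sum.inr.injEq,
          Prod.mk.injEq] at he
        have : b = a := by tauto
        simp [this]
      · simp only [frameFst, frameSnd, Sum.inr.injEq,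
          reduceCtorEq, false_or, Prod.mk.injEq] at he
        obtain ⟨⟨hk, -⟩, rfl, rfl⟩ := he
        simp [hk]
    have := hdeg _ ha
    omega
  have hcardA : #A = ∑ a, if Sum.inr (a, 0) ∈ W ∨ Sum.inr (a, 1) ∈ W then 1 else 0 := by
    simp only [A, Finset.card_filter]
  have hJ : ∀ g : Vn → ℕ, ∑ j, (if Sum.inl (Sum.inr j) ∈ W then 1 else 0) * g (G.body j) =
      ∑ a, τ a * g a := by
    intro g
    rw [← Finset.sum_fiberwise _ G.body]
    refine Finset.sum_congr rfl fun a _ => ?_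
    rw [Finset.sum_mul]
    refine Finset.sum_congr rfl fun j hj => ?_
    rw [(mem_filter.1 hj).2]
  have hcardW : #W = #P + ∑ a, τ a + ∑ a, β a := by
    have h1 : #W = #{x | x ∈ W} := by simp
    have h2 := hJ fun _ => 1
    simp only [mul_one] at h2
    rw [h1, Finset.card_filter, Fintype.sum_sum_type, Fintype.sum_sum_type, h2,
      Fintype.sum_prod_type]
    simp only [Fin.sum_univ_two, P, β, Finset.card_filter]
  have hcardE : #{e | G.frameFst e ∈ W ∧ G.frameSnd e ∈ W} =
      #F + (∑ a, (if Sum.inr (a, 0) ∈ W ∧ Sum.inr (a, 1) ∈ W then 1 else 0) +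
        ∑ a, τ a * β a) := by
    rw [Finset.card_filter, Fintype.sum_sum_type, Fintype.sum_sum_type, Fintype.sum_prod_type,
      ← hJ β]
    simp only [F, Finset.card_filter, frameFst, frameSnd, Fin.sum_univ_two, β]
    refine congrArg₂ _ rfl (congrArg₂ _ rfl (Finset.sum_congr rfl fun j _ => ?_))
    by_cases hj : Sum.inl (Sum.inr j) ∈ W <;> simp [hj]
  -- Checked body by body: equality when both base points are in `W`; with exactly one it reads `τ a
  -- + 3 ≤ 2 * τ a + 2`, which follows from `hbase`.
  have hlocal : (∑ a, (if Sum.inr (a, 0) ∈ W ∧ Sum.inr (a, 1) ∈ W then 1 else 0) +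
      ∑ a, τ a * β a) + 3 * #A ≤ 2 * ∑ a, τ a + 2 * ∑ a, β a := by
    rw [hcardA, Finset.mul_sum, Finset.mul_sum, Finset.mul_sum, ← Finset.sum_add_distrib,
      ← Finset.sum_add_distrib, ← Finset.sum_add_distrib]
    refine Finset.sum_le_sum fun a _ => ?_
    have h0 := hbase a 0
    have h1 := hbase a 1
    by_cases ha0 : Sum.inr (a, 0) ∈ W <;> by_cases ha1 : Sum.inr (a, 1) ∈ W <;>
      simp [β, ha0, ha1] at h0 h1 ⊢ <;> omega
  have hfinal : #F + 3 ≤ 3 * #A + 2 * #P := by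
    by_cases hF : F.Nonempty
    · refine h A P F hF fun e he => ?_
      have hsite : ∀ i : Vm ⊕ J, Sum.inl i ∈ W → Sum.elim (· ∈ A) (· ∈ P) (G.node i) := by
        rintro (v | j) hi
        · simpa [node, P] using hi
        · exact hbody j hi
      simp only [F, mem_filter, mem_univ, true_and] at he
      exact ⟨hsite _ he.1, hsite _ he.2⟩
    · rw [Finset.not_nonempty_iff_eq_empty] at hF
      have hA : A.Nonempty := by
        obtain ⟨e | a | ⟨j, i⟩, he⟩ := hW
        · have : e ∈ F := by simpa [F, frameFst, frameSnd] using he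
          simp [hF] at this
        · exact ⟨a, by simpa [A, frameFst] using Or.inl he.1⟩
        · exact ⟨_, hbody j he.1⟩
      have := hA.card_pos
      rw [hF, card_empty]
      omega
  omega

end BodyBarGraph

/-! ### From independent frames to independent body-bar structures -/

section Plane

theorem exists_rotation_of_orthogonal {a b u v : ℝ} (hd : a ≠ 0 ∨ b ≠ 0)
    (h : a * u + b * v = 0) : ∃ r, u = - (r * b) ∧ v = r * a := by
  have hne : a ^ 2 + b ^ 2 ≠ 0 := by
    rcases hd with hd | hd <;> positivity
  refine ⟨(a * v - b * u) / (a ^ 2 + b ^ 2), ?_, ?_⟩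
  · field_simp
    linear_combination a * h
  · field_simp
    linear_combination b * h

theorem eq_zero_of_orthogonal_of_not_parallel {a b c d u v : ℝ} (hdet : a * d - b * c ≠ 0)
    (h1 : a * u + b * v = 0) (h2 : c * u + d * v = 0) : u = 0 ∧ v = 0 := by
  constructor
  · have : (a * d - b * c) * u = 0 := by linear_combination d * h1 - b * h2
    exact (mul_eq_zero.1 this).resolve_left hdet
  · have : (a * d - b * c) * v = 0 := by linear_combination a * h2 - c * h1
    exact (mul_eq_zero.1 this).resolve_left hdet

end Plane

namespace BodyBarGraph

open Matrix Finset

variable {Vn Vm J E : Type*}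

/-- Put an arbitrary load on the external bars and none on the frames. The solution moves each frame
rigidly, so it can be read as velocities of bodies that produce the given load. -/
theorem independentAt_of_frame_independent [Fintype Vn] [Fintype Vm] [Fintype J] [Fintype E]
    [DecidableEq Vn] [DecidableEq Vm] [DecidableEq J] (G : BodyBarGraph Vn Vm J E)
    (q : (Vm ⊕ J) ⊕ (Vn × Fin 2) → Fin 2 → ℝ)
    (hq : LinearIndependent ℝ (edgeMatrix G.frameFst G.frameSnd
      (fun e => q (G.frameFst e) - q (G.frameSnd e))).row) :
    G.IndependentAt fun i => q (Sum.inl i) := by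
  classical
  have hsurj := (Matrix.linearIndependent_row_iff_mulVec_surjective _).1 hq
  have hload : ∀ b : E ⊕ (Vn ⊕ (J × Fin 2)) → ℝ,
      ∃ V : (Vm ⊕ J) ⊕ (Vn × Fin 2) → Fin 2 → ℝ, ∀ e,
        (q (G.frameFst e) 0 - q (G.frameSnd e) 0) * (V (G.frameFst e) 0 - V (G.frameSnd e) 0) +
        (q (G.frameFst e) 1 - q (G.frameSnd e) 1) * (V (G.frameFst e) 1 - V (G.frameSnd e) 1) =
          b e := by
    intro b
    obtain ⟨V, hV⟩ := hsurj b
    refine ⟨fun x k => V (x, k), fun e => ?_⟩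
    rw [← hV, edgeMatrix_mulVec]
    rfl
  have hne : ∀ e, q (G.frameFst e) 0 - q (G.frameSnd e) 0 ≠ 0 ∨
      q (G.frameFst e) 1 - q (G.frameSnd e) 1 ≠ 0 := by
    intro e
    obtain ⟨V, hV⟩ := hload fun _ => 1
    by_contra! h
    have := hV e
    rw [h.1, h.2] at this
    simp at this
  -- A joint collinear with its base points would make the three bars dependent: the base bar could
  -- not be loaded alone.
  have hdet : ∀ j : J,
      (q (Sum.inl (Sum.inr j)) 0 - q (Sum.inr (G.body j, 0)) 0) *
        (q (Sum.inl (Sum.inr j)) 1 - q (Sum.inr (G.body j, 1)) 1) -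
      (q (Sum.inl (Sum.inr j)) 1 - q (Sum.inr (G.body j, 0)) 1) *
        (q (Sum.inl (Sum.inr j)) 0 - q (Sum.inr (G.body j, 1)) 0) ≠ 0 := by
    intro j hzero
    obtain ⟨V, hV⟩ := hload (Pi.single (Sum.inr (Sum.inl (G.body j))) 1)
    have h0 := hV (Sum.inr (Sum.inr (j, 0)))
    have h1 := hV (Sum.inr (Sum.inr (j, 1)))
    have h2 := hV (Sum.inr (Sum.inl (G.body j)))
    rw [Pi.single_eq_of_ne (by simp)] at h0 h1
    rw [Pi.single_eq_same] at h2
    have hne0 := hne (Sum.inr (Sum.inr (j, 0)))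
    have hne1 := hne (Sum.inr (Sum.inr (j, 1)))
    simp only [frameFst, frameSnd] at h0 h1 h2 hne0 hne1
    obtain ⟨r, hr0, hr1⟩ := exists_rotation_of_orthogonal hne0 h0
    obtain ⟨r', hr0', hr1'⟩ := exists_rotation_of_orthogonal hne1 h1
    refine zero_ne_one (Eq.trans ?_ h2)
    linear_combination (-(q (Sum.inr (G.body j, 0)) 0 - q (Sum.inr (G.body j, 1)) 0)) * hr0' +
      (q (Sum.inr (G.body j, 0)) 0 - q (Sum.inr (G.body j, 1)) 0) * hr0 -
      (q (Sum.inr (G.body j, 0)) 1 - q (Sum.inr (G.body j, 1)) 1) * hr1' +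
      (q (Sum.inr (G.body j, 0)) 1 - q (Sum.inr (G.body j, 1)) 1) * hr1 + (r - r') * hzero
  refine (Matrix.linearIndependent_row_iff_mulVec_surjective _).2 fun b => ?_
  obtain ⟨V, hV⟩ := hload (Sum.elim b 0)
  have hmotion : ∀ a : Vn, ∃ m : Fin 3 → ℝ, ∀ i : Fin 2,
      V (Sum.inr (a, i)) 0 = m 0 - m 2 * q (Sum.inr (a, i)) 1 ∧
      V (Sum.inr (a, i)) 1 = m 1 + m 2 * q (Sum.inr (a, i)) 0 := by
    intro a
    obtain ⟨r, hr0, hr1⟩ := exists_rotation_of_orthogonal (hne (Sum.inr (Sum.inl a)))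
      (hV (Sum.inr (Sum.inl a)))
    simp only [frameFst, frameSnd] at hr0 hr1
    -- The motion with angular velocity `r` that agrees with `V` at the first base point, expressed
    -- by its velocity at the origin.
    refine ⟨![V (Sum.inr (a, 0)) 0 + r * q (Sum.inr (a, 0)) 1,
      V (Sum.inr (a, 0)) 1 - r * q (Sum.inr (a, 0)) 0, r], ?_⟩
    rw [Fin.forall_fin_two]
    refine ⟨⟨?_, ?_⟩, ?_, ?_⟩ <;> simp <;> linarith
  choose m hm using hmotion
  have hjoint : ∀ j : J,
      V (Sum.inl (Sum.inr j)) 0 = m (G.body j) 0 - m (G.body j) 2 * q (Sum.inl (Sum.inr j)) 1 ∧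
      V (Sum.inl (Sum.inr j)) 1 = m (G.body j) 1 + m (G.body j) 2 * q (Sum.inl (Sum.inr j)) 0 := by
    intro j
    have h0 := hV (Sum.inr (Sum.inr (j, 0)))
    have h1 := hV (Sum.inr (Sum.inr (j, 1)))
    obtain ⟨h00, h01⟩ := hm (G.body j) 0
    obtain ⟨h10, h11⟩ := hm (G.body j) 1
    simp only [frameFst, frameSnd, Sum.elim_inr, Pi.zero_apply] at h0 h1
    rw [h00, h01] at h0
    rw [h10, h11] at h1
    -- The deviation of the joint from the rigid motion of its body is orthogonal to both frame
    -- bars, which are not parallel.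
    have := eq_zero_of_orthogonal_of_not_parallel
      (u := V (Sum.inl (Sum.inr j)) 0 -
        (m (G.body j) 0 - m (G.body j) 2 * q (Sum.inl (Sum.inr j)) 1))
      (v := V (Sum.inl (Sum.inr j)) 1 -
        (m (G.body j) 1 + m (G.body j) 2 * q (Sum.inl (Sum.inr j)) 0)) (hdet j)
      (by linear_combination h0) (by linear_combination h1)
    exact ⟨sub_eq_zero.1 this.1, sub_eq_zero.1 this.2⟩
  let x : (Vn × Fin 3) ⊕ (Vm × Fin 2) → ℝ :=
    Sum.elim (fun c => m c.1 c.2) fun c => V (Sum.inl (Sum.inl c.1)) c.2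
  have hpair : ∀ (L : Fin 3 → ℝ) (i : Vm ⊕ J),
      L 2 = L 1 * q (Sum.inl i) 0 - L 0 * q (Sum.inl i) 1 →
      nodePairing x L (G.node i) = L 0 * V (Sum.inl i) 0 + L 1 * V (Sum.inl i) 1 := by
    rintro L (v | j) hL
    · simp [nodePairing, node, x, Fin.sum_univ_two]
    · simp only [nodePairing, node, x, Fin.sum_univ_three, Sum.elim_inl, Sum.elim_inr]
      rw [(hjoint j).1, (hjoint j).2, hL]
      ring
  refine ⟨x, funext fun e => ?_⟩
  rw [rigidityMatrix_mulVec, hpair _ _ (lineBound_two_eq_left _ _),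
    hpair _ _ (lineBound_two_eq_right _ _)]
  have := hV (Sum.inl e)
  simp only [frameFst, frameSnd, Sum.elim_inl] at this
  rw [← this]
  simp only [lineBound, Matrix.cons_val_zero, Matrix.cons_val_one]
  ring

/-- Independence at one realization implies independence at every generic realization. -/
theorem IndependentAt.of_generic [Finite Vn] [Finite Vm] [Finite E] {G : BodyBarGraph Vn Vm J E}
    {p q : Vm ⊕ J → Fin 2 → ℝ} (hq : G.IndependentAt q) (hp : IsGeneric p) :
    G.IndependentAt p := by
  classical
  let I : E → Vn ⊕ Vm → MvPolynomial ((Vm ⊕ J) × Fin 2) ℚ := fun e v =>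
    (if G.node (G.fst e) = v then 1 else 0) - (if G.node (G.snd e) = v then 1 else 0)
  let x : Vm ⊕ J → Fin 2 → MvPolynomial ((Vm ⊕ J) × Fin 2) ℚ := fun i k => MvPolynomial.X (i, k)
  let L : E → Fin 3 → MvPolynomial ((Vm ⊕ J) × Fin 2) ℚ := fun e =>
    ![x (G.fst e) 0 - x (G.snd e) 0, x (G.fst e) 1 - x (G.snd e) 1,
      x (G.snd e) 0 * x (G.fst e) 1 - x (G.snd e) 1 * x (G.fst e) 0]
  let M : Matrix E ((Vn × Fin 3) ⊕ (Vm × Fin 2)) (MvPolynomial ((Vm ⊕ J) × Fin 2) ℚ) :=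
    Matrix.of fun e => Sum.elim (fun c => I e (Sum.inl c.1) * L e c.2)
      fun c => I e (Sum.inr c.1) * L e c.2.castSucc
  have hI : ∀ (p : Vm ⊕ J → Fin 2 → ℝ) e v,
      MvPolynomial.aeval (fun s : (Vm ⊕ J) × Fin 2 => p s.1 s.2) (I e v) = G.incidence e v := by
    intro p e v
    simp only [I, incidence, map_sub]
    congr 1 <;> split_ifs <;> simp
  have hL : ∀ (p : Vm ⊕ J → Fin 2 → ℝ) e k,
      MvPolynomial.aeval (fun s : (Vm ⊕ J) × Fin 2 => p s.1 s.2) (L e k) =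
        lineBound (p (G.fst e)) (p (G.snd e)) k := by
    intro p e k
    fin_cases k <;> simp [L, x, lineBound]
  have hM : ∀ p : Vm ⊕ J → Fin 2 → ℝ,
      M.map (MvPolynomial.aeval fun s : (Vm ⊕ J) × Fin 2 => p s.1 s.2) = G.rigidityMatrix p := by
    intro p
    ext e (⟨a, k⟩ | ⟨v, k⟩) <;> simp [M, rigidityMatrix, hI, hL]
  unfold IndependentAt at hq ⊢
  rw [← hM] at hq ⊢
  exact AlgebraicIndependent.linearIndependent_row M hp hq

/-! ### Quadrupled edges and the equivalences -/

theorem toMultigraph_ends (G : BodyBarGraph Vn Vm J E) (e : E) :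
    G.toMultigraph.ends e = s(G.node (G.fst e), G.node (G.snd e)) := rfl

theorem mem_toMultigraph_ends (G : BodyBarGraph Vn Vm J E) (e : E) (Q : Vn ⊕ Vm → Prop) :
    (∀ v ∈ G.toMultigraph.ends e, Q v) ↔ Q (G.node (G.fst e)) ∧ Q (G.node (G.snd e)) := by
  rw [toMultigraph_ends, Sym2.ball]

/-- The three added copies account for the `+ 3`: the extremal subgraphs contain all of them. -/
theorem isSparse_iff_forall_sub [Fintype E] (G : BodyBarGraph Vn Vm J E) :
    G.IsSparse ↔ ∀ e : E, ∀ H : (G.toMultigraph.quadruple e).Sub,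
      ¬ (H.edges.card > 3 * H.bodies.card + 2 * H.points.card) := by
  classical
  constructor
  · intro h e H
    rw [gt_iff_lt, not_lt]
    rcases H.edges.eq_empty_or_nonempty with hempty | hne
    · simp [hempty]
    -- Added copies are sent to `e`, so `F` is nonempty even if `H` consists of added copies only.
    let F : Finset E := H.edges.image (Sum.elim id fun _ => e)
    have hF : F.Nonempty := hne.image _
    have hends : ∀ f ∈ F, Sum.elim (· ∈ H.bodies) (· ∈ H.points) (G.node (G.fst f)) ∧
        Sum.elim (· ∈ H.bodies) (· ∈ H.points) (G.node (G.snd f)) := by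
      intro f hf
      obtain ⟨g | k, hg, rfl⟩ := Finset.mem_image.1 hf
      · exact (G.mem_toMultigraph_ends g _).1 (H.ends_mem _ hg)
      · exact (G.mem_toMultigraph_ends e _).1 (H.ends_mem _ hg)
    refine le_trans ?_ (h H.bodies H.points F hF hends)
    have hsub : H.edges ⊆ F.disjSum (Finset.univ : Finset (Fin 3)) := by
      rintro (g | k) hg
      · exact Finset.inl_mem_disjSum.2 (Finset.mem_image.2 ⟨_, hg, rfl⟩)
      · exact Finset.inr_mem_disjSum.2 (Finset.mem_univ k)
    simpa using Finset.card_le_card hsub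
  · intro h A P F hF hends
    obtain ⟨e, he⟩ := hF
    have := h e ⟨A, P, F.disjSum Finset.univ, by
      rintro (f | k) hf
      · exact (G.mem_toMultigraph_ends f _).2 (hends f (Finset.inl_mem_disjSum.1 hf))
      · exact (G.mem_toMultigraph_ends e _).2 (hends e he)⟩
    simpa using this

end BodyBarGraph

theorem mainTheorem2 {Vn Vm J E : Type*} [Finite Vn] [Finite Vm] [Finite J] [Finite E]
    (G : BodyBarGraph Vn Vm J E) (hG : G.GenericIncidence) :
    List.TFAE [
      G.IndependentIn2D,
      ∃ p : Vm ⊕ J → Fin 2 → ℝ, BodyBarGraph.IsGeneric p ∧ G.IndependentAt p,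
      ∀ e : E, ∀ H : (G.toMultigraph.quadruple e).Sub,
        ¬ (H.edges.card > 3 * H.bodies.card + 2 * H.points.card),
      ∀ e : E, ¬ (G.toMultigraph.quadruple e).HasDeficientSet,
      ∀ e : E, (G.toMultigraph.quadruple e).HasCompleteMatching] := by
  classical
  cases nonempty_fintype Vn
  cases nonempty_fintype Vm
  cases nonempty_fintype J
  cases nonempty_fintype E
  tfae_have 1 → 2 := by
    intro h
    obtain ⟨p, hp⟩ := exists_algebraicIndependent_real ((Vm ⊕ J) × Fin 2)
    exact ⟨fun i k => p (i, k), hp, h _ hp⟩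
  tfae_have 2 → 3 := by
    rintro ⟨p, hp, h⟩
    exact G.isSparse_iff_forall_sub.1 fun A P F hF hends => h.card_add_three_le hp A P F hF hends
  tfae_have 3 → 1 := by
    intro h p hp
    have hs := G.isSparse_iff_forall_sub.2 h
    obtain ⟨q, hq⟩ := exists_placement_of_sparse G.frameFst G.frameSnd (hs.frame_sparse hG)
    exact (G.independentAt_of_frame_independent q hq).of_generic hp
  tfae_have 3 ↔ 4 := by
    simp only [MixedMultigraph.hasDeficientSet_iff_exists_sub, not_exists]
  tfae_have 4 ↔ 5 :=
    forall_congr' fun e => MixedMultigraph.not_hasDeficientSet_iff_hasCompleteMatching _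
  tfae_finish
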